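/- Let $\mathbb K=\mathbb Q(i)$ or $\mathbb Q(\omega)$ ($\omega$ a primitive cube root of unity), let $\mathbb L/\mathbb K$ be a cyclic Galois extension of degree $n$, with $\mathbb L\subset\mathbb C$ and with Galois group generated by $\sigma$, and let $\gamma\in\mathcal O_{\mathbb K}$ be such that none of $\gamma,\gamma^2,\ldots,\gamma^{n-1}$ is the norm of an element of $\mathbb L$. For $x=(x_0,\ldots,x_{n-1})\in\mathcal O_{\mathbb L}^n$ let $\mathbf X(x)$ be the $n\times n$ matrix whose entry in row $m$ and column $j$ ($0\le m,j\le n-1$) is $\sigma^m(x_{j-m})$ if $j\ge m$ and $\gamma\,\sigma^m(x_{n+j-m})$ if $j<m$. For an ideal $\mathfrak J$ of $\mathcal O_{\mathbb L}$ put $\mathcal C_{\mathfrak J}=\{\mathbf X(x): x_0,\ldots,x_{n-1}\in\mathfrak J\}$. Let $\mathfrak I$ be a non-principal ideal of $\mathcal O_{\mathbb L}$, let $\mathfrak q_1,\ldots,\mathfrak q_K$ be pairwise relatively prime ideals of $\mathcal O_{\mathbb L}$, each relatively prime to $\mathfrak I$, and put $\mathfrak q=\mathfrak q_1\cdots\mathfrak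 q_K$. By the second isomorphism theorem and the Chinese remainder theorem, $x\mapsto(x \bmod \mathfrak q_k)_k$ induces an isomorphism $\mathfrak I/\mathfrak I\mathfrak q\cong\prod_{k}\mathcal O_{\mathbb L}/\mathfrak q_k$. Let $\mathcal M:\prod_k\mathcal O_{\mathbb L}/\mathfrak q_k\to\mathfrak I$ be its inverse followed by the choice of a complete set of coset leaders of $\mathfrak I/\mathfrak I\mathfrak q$. The layered space-time index code (LSTIC) encodes messages $w_k=(w_{k,0},\ldots,w_{k,n-1})\in(\mathcal O_{\mathbb L}/\mathfrak q_k)^n$, $k=1,\ldots,K$, into $\mathbf X(x)$ with $x_\ell=\mathcal M(w_{1,\ell},\ldots,w_{K,\ell})$. Let $\mathcal C$ be the set of all these codewords, and for $\mathcal S\subseteq\{1,\ldots,K\}$ and given values $v_s$, $s\in\mathcal S$, let $\mathcal C_{\mathcal S}$ be the set of the codewords with $w_s=v_s$ for all $s\in\mathcal S$. As usual for codes carved from a lattice, the minimum determinant is that of the underlying (translated) lattice: for $\mathcal D=\mathcal C$ or $\mathcal D=\mathcal C_{\mathcal S}$, $$\delta(\mathcal D)=\min\{\det\big((\mathbf X-\mathbf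 X')(\mathbf X-\mathbf X')^\dagger\big): \mathbf X\ne\mathbf X',\ \mathbf X,\mathbf X'\in\mathcal D+\mathcal C_{\mathfrak I\mathfrak q}\}$$ (for $\mathcal D=\mathcal C$ one has $\mathcal D+\mathcal C_{\mathfrak I\mathfrak q}=\mathcal C_{\mathfrak I}$). The rate of $w_k$ is $R_k=\frac1{2n^2}\log_2|(\mathcal O_{\mathbb L}/\mathfrak q_k)^n|$ bits per real symbol, $R_{\mathcal S}=\sum_{s\in\mathcal S}R_s$, and the normalized side information gain is $$\Gamma(\mathcal C,\mathcal S)=\frac{10\log_{10}\big(\delta(\mathcal C_{\mathcal S})/\delta(\mathcal C)\big)}{n\,R_{\mathcal S}}.$$ Theorem. All these minima exist, and $\delta(\mathcal C)>0$. For every $\mathcal S\subseteq\{1,\ldots,K\}$ with $R_{\mathcal S}>0$ and all values $v_s$, $s\in\mathcal S$, $$\Gamma(\mathcal C,\mathcal S)\ \ge\ 20\log_{10}2+\gamma_{\mathfrak I}\ \ge\ 6+\gamma_{\mathfrak I}\quad\text{dB/bits per real symbol},$$ where $$\gamma_{\mathfrak I}=20\log_{10}\left(\frac{N(\mathfrak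 I)}{\min_{0\ne x\in\mathfrak I}N_{\mathbb L/\mathbb Q}(x)}\right)$$ is negative, and depends only on $\mathfrak I$ and not on $\mathcal S$. -/

import Mathlib

open scoped NumberField

noncomputable section

namespace LSTIC

/-! ### Codeword matrices of the cyclic algebra `(L/K, σ, γ)` -/

section Codes

variable {K L : Type*} [Field K] [Field L] [Algebra K L] {n : ℕ}

/-- The `n × n` matrix of `x₀ + x₁ e + ⋯ + x_{n-1} e^{n-1}`, with complex entries through a fixed
embedding `ι : L → ℂ`. Row `m` (counted from `0`) is
`(γ σ^m(x_{n-m}), …, γ σ^m(x_{n-1}), σ^m(x_0), …, σ^m(x_{n-1-m}))`;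
the subtraction `j - m` of indices in `Fin n` is modulo `n`. -/
def codeword (ι : L →+* ℂ) (σ : L ≃ₐ[K] L) (γ : 𝓞 K) (x : Fin n → 𝓞 L) :
    Matrix (Fin n) (Fin n) ℂ :=
  Matrix.of fun m j =>
    ι ((if j < m then algebraMap K L (γ : K) else 1) * (σ ^ (m : ℕ)) (x (j - m) : L))

/-- The lattice code `C_J` of an ideal `J`: all codeword matrices with every layer in `J`. -/
def idealCode (n : ℕ) (ι : L →+* ℂ) (σ : L ≃ₐ[K] L) (γ : 𝓞 K) (J : Ideal (𝓞 L)) :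
    Set (Matrix (Fin n) (Fin n) ℂ) :=
  {X | ∃ x : Fin n → 𝓞 L, (∀ l, x l ∈ J) ∧ X = codeword ι σ γ x}

/-- The values `det ((X - X') (X - X')ᴴ)` for distinct members `X`, `X'` of a set of matrices
(each of these determinants is a real number). -/
def detValues (C : Set (Matrix (Fin n) (Fin n) ℂ)) : Set ℝ :=
  {d | ∃ X ∈ C, ∃ X' ∈ C, X ≠ X' ∧ (d : ℂ) = ((X - X') * (X - X').conjTranspose).det}

/-- The minimum determinant of a set of matrices. -/
def minDet (C : Set (Matrix (Fin n) (Fin n) ℂ)) : ℝ :=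
  sInf (detValues C)

end Codes

/-! ### The encoding of the messages -/

section Encoding

variable {L : Type*} [Field L] {κ : ℕ}

/-- `I 𝔮` with `𝔮 = 𝔮₁ ⋯ 𝔮_κ`, as a submodule of `I`. -/
def shaping (I : Ideal (𝓞 L)) (q : Fin κ → Ideal (𝓞 L)) : Submodule (𝓞 L) I :=
  Submodule.comap (Submodule.subtype I) (I * ∏ k, q k)

/-- The residues `(x mod 𝔮₁, …, x mod 𝔮_κ)` of an element `x` of `I`. -/
def residues (I : Ideal (𝓞 L)) (q : Fin κ → Ideal (𝓞 L)) :
    I →ₗ[𝓞 L] ((k : Fin κ) → 𝓞 L ⧸ q k) :=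
  LinearMap.pi fun k => (q k).mkQ.comp (Submodule.subtype I)

theorem ker_residues (I : Ideal (𝓞 L)) (q : Fin κ → Ideal (𝓞 L))
    (hq : Pairwise fun i j => IsCoprime (q i) (q j)) (hI : ∀ k, IsCoprime I (q k)) :
    LinearMap.ker (residues I q) = shaping I q := by
  have h1 : IsCoprime I (∏ k, q k) := IsCoprime.prod_right fun k _ => hI k
  have h2 : ∏ k, q k = ⨅ k, q k := by
    simpa using Ideal.prod_eq_iInf_of_pairwise_isCoprime (s := Finset.univ) (J := q)
      fun i _ j _ h => hq h
  ext x
  simp only [shaping, LinearMap.mem_ker, Submodule.mem_comap, Ideal.mul_eq_inf_of_isCoprime h1]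
  simp [h2, residues, funext_iff, Submodule.mem_iInf, Ideal.Quotient.eq_zero_iff_mem]

theorem residues_surjective (I : Ideal (𝓞 L)) (q : Fin κ → Ideal (𝓞 L))
    (hq : Pairwise fun i j => IsCoprime (q i) (q j)) (hI : ∀ k, IsCoprime I (q k)) :
    Function.Surjective (residues I q) := by
  intro w
  have h1 : IsCoprime I (∏ k, q k) := IsCoprime.prod_right fun k _ => hI k
  obtain ⟨a, ha⟩ := Ideal.pi_quotient_surjective hq w
  obtain ⟨i, hi, j, hj, hij⟩ := Ideal.isCoprime_iff_exists.1 h1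
  refine ⟨⟨i * a, I.mul_mem_right a hi⟩, ?_⟩
  funext k
  have hk : j ∈ q k := Ideal.prod_le_inf.trans (Finset.inf_le (Finset.mem_univ k)) hj
  rw [← ha k]
  change Ideal.Quotient.mk (q k) (i * a) = Ideal.Quotient.mk (q k) a
  rw [Ideal.Quotient.eq]
  have : i * a - a = -(a * j) := by linear_combination a * hij
  rw [this]
  exact neg_mem ((q k).mul_mem_left a hk)

/-- The isomorphism `I/I𝔮 ≅ 𝓞_L/𝔮₁ × ⋯ × 𝓞_L/𝔮_κ` which the second isomorphism theorem and the
Chinese remainder theorem give: the class of `x ∈ I` goes to the residues of `x`. -/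
def layerEquiv (I : Ideal (𝓞 L)) (q : Fin κ → Ideal (𝓞 L))
    (hq : Pairwise fun i j => IsCoprime (q i) (q j)) (hI : ∀ k, IsCoprime I (q k)) :
    (I ⧸ shaping I q) ≃ₗ[𝓞 L] ((k : Fin κ) → 𝓞 L ⧸ q k) :=
  (Submodule.quotEquivOfEq _ _ (ker_residues I q hq hI).symm).trans
    ((residues I q).quotKerEquivOfSurjective (residues_surjective I q hq hI))

/-- The layers of the codeword of the messages `w₁, …, w_κ`. The message `w_k` consists of `n`
sub-messages `w_{k,l} ∈ 𝓞_L/𝔮_k`, and layer `l` carries the coset leader (chosen by `leader`) of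
the class in `I/I𝔮` that corresponds to `(w_{1,l}, …, w_{κ,l})`. -/
def layers {n : ℕ} (I : Ideal (𝓞 L)) (q : Fin κ → Ideal (𝓞 L))
    (hq : Pairwise fun i j => IsCoprime (q i) (q j)) (hI : ∀ k, IsCoprime I (q k))
    (leader : I ⧸ shaping I q → I) (w : (k : Fin κ) → Fin n → 𝓞 L ⧸ q k) : Fin n → 𝓞 L :=
  fun l => (leader ((layerEquiv I q hq hI).symm fun k => w k l) : 𝓞 L)

variable {K : Type*} [Field K] [Algebra K L]

/-- The codebook: the codewords of all message tuples. -/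
def codebook (n : ℕ) (ι : L →+* ℂ) (σ : L ≃ₐ[K] L) (γ : 𝓞 K) (I : Ideal (𝓞 L))
    (q : Fin κ → Ideal (𝓞 L)) (hq : Pairwise fun i j => IsCoprime (q i) (q j))
    (hI : ∀ k, IsCoprime I (q k)) (leader : I ⧸ shaping I q → I) :
    Set (Matrix (Fin n) (Fin n) ℂ) :=
  {X | ∃ w : (k : Fin κ) → Fin n → 𝓞 L ⧸ q k,
    X = codeword ι σ γ (layers I q hq hI leader w)}

/-- The subcode left to a receiver that knows `w_s = v_s` for all `s ∈ S`. -/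
def subcode {n : ℕ} (ι : L →+* ℂ) (σ : L ≃ₐ[K] L) (γ : 𝓞 K) (I : Ideal (𝓞 L))
    (q : Fin κ → Ideal (𝓞 L)) (hq : Pairwise fun i j => IsCoprime (q i) (q j))
    (hI : ∀ k, IsCoprime I (q k)) (leader : I ⧸ shaping I q → I)
    (S : Finset (Fin κ)) (v : (k : Fin κ) → Fin n → 𝓞 L ⧸ q k) :
    Set (Matrix (Fin n) (Fin n) ℂ) :=
  {X | ∃ w : (k : Fin κ) → Fin n → 𝓞 L ⧸ q k, (∀ s ∈ S, w s = v s) ∧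
    X = codeword ι σ γ (layers I q hq hI leader w)}

/-- The (translate of a) lattice from which a set `C` of codewords is carved: `C + C_{I𝔮}`, where
only the class of each layer modulo the shaping lattice `I𝔮` matters. The minimum determinant of a
code carved from a lattice is, by convention, that of the lattice. -/
def periodic {n : ℕ} (ι : L →+* ℂ) (σ : L ≃ₐ[K] L) (γ : 𝓞 K) (I : Ideal (𝓞 L))
    (q : Fin κ → Ideal (𝓞 L)) (C : Set (Matrix (Fin n) (Fin n) ℂ)) :
    Set (Matrix (Fin n) (Fin n) ℂ) :=
  {Z | ∃ X ∈ C, ∃ Y ∈ idealCode n ι σ γ (I * ∏ k, q k), Z = X + Y}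

end Encoding

/-! ### Rates, side information gain, and the constant `γ_I` -/

section Gain

variable {L : Type*} [Field L] {κ : ℕ}

/-- The rate, in bits per real symbol, of a message with values in `(𝓞_L/𝔮_k)^n`; an `n × n`
complex codeword carries `2 n²` real symbols. -/
def messageRate (n : ℕ) (qk : Ideal (𝓞 L)) : ℝ :=
  Real.logb 2 (Nat.card (Fin n → 𝓞 L ⧸ qk)) / (2 * (n : ℝ) ^ 2)

/-- The rate of the side information `w_S`. -/
def sideInfoRate (n : ℕ) (q : Fin κ → Ideal (𝓞 L)) (S : Finset (Fin κ)) : ℝ :=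
  ∑ s ∈ S, messageRate n (q s)

/-- The normalized side information gain, in dB per bit per real symbol, for `n` transmit antennas,
a code carved from `C` which side information of rate `R` reduces to one carved from `CS`. -/
def gain {n : ℕ} (C CS : Set (Matrix (Fin n) (Fin n) ℂ)) (R : ℝ) : ℝ :=
  10 * Real.logb 10 (minDet CS / minDet C) / (n * R)

/-- The norms `N_{L/ℚ}(x)` of the nonzero elements `x` of `I`. -/
def normValues [NumberField L] (I : Ideal (𝓞 L)) : Set ℝ :=
  {m | ∃ x ∈ I, x ≠ 0 ∧ m = (Algebra.norm ℚ (x : L) : ℝ)}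

/-- `γ_I = 20 log₁₀ (N(I) / min_{0 ≠ x ∈ I} N_{L/ℚ}(x))`. -/
def gammaI [NumberField L] (I : Ideal (𝓞 L)) : ℝ :=
  20 * Real.logb 10 ((Ideal.absNorm I : ℝ) / sInf (normValues I))

end Gain

end LSTIC

end

/-!
Let `φ` be left multiplication by `e` in the cyclic algebra `⨁ L e ^ j`: it is `σ`-semilinear with
`φ ^ n = γ`. On a `φ`-stable subspace of dimension `d`, the determinant `y` of `φ` in a basis
satisfies `N_{L/K}(y) = γ ^ d`. The kernel of right multiplication by `x ≠ 0` is such a subspace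
with `d < n`, so `d = 0` by the hypothesis on `γ`, and codeword determinants do not vanish.

Right multiplication commutes with `φ`, so its determinant is fixed by `σ` and lies in `𝓞_K`; the
rows of the matrix put it into `∏ σ ^ m J` when the layers lie in `J`. Comparing norms, the square
of its absolute value is a positive multiple of `N(J)`. Side information `w_S` replaces `C_I` by a
translate of `C_{I 𝔮_S}`, where `𝔮_S` is the product of the `𝔮_s`, `s ∈ S`. Hence
`δ(C_S) ≥ N(I) N(𝔮_S)`, while diagonal codewords give `δ(C) ≤ min N_{L/ℚ}(x)` and
`n R_S = log₂ N(𝔮_S) / 2`.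
-/

namespace LSTIC

section SemilinearDet

variable {R M ι : Type*} [CommRing R] [AddCommGroup M] [Module R M] [Fintype ι] [DecidableEq ι]

theorem det_vecMulLinear (A : Matrix ι ι R) : LinearMap.det A.vecMulLinear = A.det := by
  rw [← Matrix.mulVecLin_transpose, ← Matrix.toLin'_apply', LinearMap.det_toLin',
    Matrix.det_transpose]

theorem det_comp_semilinear {σ : R →+* R} (b : Module.Basis ι R M) (φ : M →ₛₗ[σ] M) (v : ι → M) :
    b.det (φ ∘ v) = b.det (φ ∘ b) * σ (b.det v) := by
  have h : b.toMatrix (φ ∘ v) = b.toMatrix (φ ∘ b) * (b.toMatrix v).map σ := by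
    ext i j
    have hv : φ (v j) = ∑ k, σ (b.repr (v j) k) • φ (b k) := by
      conv_lhs => rw [← b.sum_repr (v j)]
      simp only [map_sum, map_smulₛₗ]
    simp [Module.Basis.toMatrix_apply, Matrix.mul_apply, hv, mul_comm]
  rw [b.det_apply, h, Matrix.det_mul, ← RingHom.mapMatrix_apply, ← RingHom.map_det,
    ← b.det_apply, ← b.det_apply]

theorem map_det_of_comp_semilinear [IsDomain R] {σ : R →+* R} (b : Module.Basis ι R M)
    {φ : M →ₛₗ[σ] M} (hφ : b.det (φ ∘ b) ≠ 0) {f : M →ₗ[R] M} (h : ∀ x, φ (f x) = f (φ x)) :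
    σ (LinearMap.det f) = LinearMap.det f := by
  have hcomm : φ ∘ f ∘ b = f ∘ φ ∘ b := funext fun i => h (b i)
  have hdet := det_comp_semilinear b φ (f ∘ b)
  rw [hcomm, b.det_comp, b.det_comp, b.det_self, mul_one, mul_comm] at hdet
  exact (mul_left_cancel₀ hφ hdet).symm

variable {G : Type*} [Group G] [MulSemiringAction G R]

theorem det_iterate_comp_semilinear {g : G} (b : Module.Basis ι R M)
    (φ : M →ₛₗ[MulSemiringAction.toRingHom G R g] M) (r : ℕ) :
    b.det (φ^[r] ∘ b) = ∏ i ∈ Finset.range r, g ^ i • b.det (φ ∘ b) := by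
  induction r with
  | zero => simp [b.det_self]
  | succ r ih =>
    rw [Function.iterate_succ', Function.comp_assoc, det_comp_semilinear, ih,
      Finset.prod_range_succ', mul_comm, map_prod]
    simp [pow_succ', mul_smul]

theorem prod_smul_det_eq_pow_card {g : G} {n : ℕ} {c : R} (b : Module.Basis ι R M)
    (φ : M →ₛₗ[MulSemiringAction.toRingHom G R g] M) (hφ : ∀ x, φ^[n] x = c • x) :
    ∏ i ∈ Finset.range n, g ^ i • b.det (φ ∘ b) = c ^ Fintype.card ι := by
  have h : φ^[n] ∘ b = fun i => c • b i := funext fun i => hφ (b i)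
  rw [← det_iterate_comp_semilinear, h, ← AlternatingMap.coe_multilinearMap,
    MultilinearMap.map_smul_univ, AlternatingMap.coe_multilinearMap, b.det_self]
  simp

end SemilinearDet

section CyclicAlgebra

variable {G R : Type*} [Group G] [CommRing R] [MulSemiringAction G R] {n : ℕ} [NeZero n]

/-- Left multiplication by `e` in the cyclic algebra `⨁ R e ^ j`, where `e r = (σ • r) e` and
`e ^ n = γ`, in coordinates with respect to `1, e, …, e ^ (n - 1)`. -/
def shift (σ : G) (γ : R) :
    (Fin n → R) →ₛₗ[MulSemiringAction.toRingHom G R σ] (Fin n → R) where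
  toFun v j := (if j = 0 then γ else 1) * σ • v (j - 1)
  map_add' v w := by ext; simp [mul_add]
  map_smul' c v := by ext; simp [smul_mul', mul_left_comm]

theorem shift_apply (σ : G) (γ : R) (v : Fin n → R) (j : Fin n) :
    shift σ γ v j = (if j = 0 then γ else 1) * σ • v (j - 1) := rfl

/-- The matrix of right multiplication by `x₀ + x₁ e + ⋯ + x_{n-1} e ^ (n - 1)` in the same
coordinates: its row `m` is `e ^ m` times that element. -/
def layerMatrix (σ : G) (γ : R) (x : Fin n → R) : Matrix (Fin n) (Fin n) R :=
  Matrix.of fun m => (shift σ γ)^[m] x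

variable {σ : G} {γ : R}

theorem val_sub_one (j : Fin n) : (j - 1).val = if j = 0 then n - 1 else j.val - 1 := by
  obtain ⟨k, rfl⟩ := Nat.exists_eq_succ_of_ne_zero (NeZero.ne n)
  exact Fin.coe_sub_one j

theorem iterate_shift_apply (hγ : σ • γ = γ) (v : Fin n → R) {r : ℕ} (hr : r ≤ n) (j : Fin n) :
    (shift σ γ)^[r] v j = (if j.val < r then γ else 1) * σ ^ r • v (j - Fin.ofNat n r) := by
  induction r generalizing j with
  | zero => simp
  | succ r ih =>
    have hidx : j - 1 - Fin.ofNat n r = j - Fin.ofNat n (r + 1) := by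
      have : Fin.ofNat n (r + 1) = Fin.ofNat n r + 1 := by ext; simp [Fin.val_add]
      rw [this]
      abel
    have hlt : (j - 1).val < r ↔ j ≠ 0 ∧ j.val < r + 1 := by
      rw [val_sub_one]
      split_ifs with hj
      · simp only [hj, ne_eq, not_true_eq_false, false_and, iff_false]
        omega
      · have := Fin.val_ne_zero_iff.2 hj
        simp only [ne_eq, hj, not_false_eq_true, true_and]
        omega
    rw [Function.iterate_succ_apply', shift_apply, ih (by omega), smul_mul', ← mul_assoc, hidx,
      smul_smul, ← pow_succ', apply_ite (σ • · : R → R), hγ, smul_one]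
    simp only [hlt]
    congr 1
    rcases eq_or_ne j 0 with rfl | hj <;> simp_all

theorem layerMatrix_apply (hγ : σ • γ = γ) (x : Fin n → R) (m j : Fin n) :
    layerMatrix σ γ x m j = (if j < m then γ else 1) * σ ^ m.val • x (j - m) := by
  simp [layerMatrix, iterate_shift_apply hγ x m.is_lt.le]

theorem iterate_shift_eq_smul (hσ : σ ^ n = 1) (hγ : σ • γ = γ) (v : Fin n → R) :
    (shift σ γ)^[n] v = γ • v := by
  ext j
  rw [iterate_shift_apply hγ v le_rfl]
  simp [hσ]

theorem iterate_shift_succ_val (hσ : σ ^ n = 1) (hγ : σ • γ = γ) (x : Fin n → R) (m : Fin n) :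
    (shift σ γ)^[m.val + 1] x = (if m + 1 = 0 then γ else 1) • (shift σ γ)^[(m + 1).val] x := by
  have h := val_sub_one (m + 1)
  rw [add_sub_cancel_right] at h
  by_cases hm : m + 1 = 0
  · have hn : m.val + 1 = n := by
      rw [h, if_pos hm, Nat.sub_add_cancel NeZero.one_le]
    simp [hm, hn, iterate_shift_eq_smul hσ hγ]
  · have h0 := Fin.val_ne_zero_iff.2 hm
    rw [if_neg hm] at h ⊢
    rw [one_smul, h, Nat.sub_add_cancel (Nat.one_le_iff_ne_zero.2 h0)]

theorem shift_vecMul_layerMatrix (hσ : σ ^ n = 1) (hγ : σ • γ = γ) (x v : Fin n → R) :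
    shift σ γ (Matrix.vecMul v (layerMatrix σ γ x)) =
      Matrix.vecMul (shift σ γ v) (layerMatrix σ γ x) := by
  have hrow (m : Fin n) : shift σ γ (layerMatrix σ γ x m) =
      (if m + 1 = 0 then γ else 1) • layerMatrix σ γ x (m + 1) :=
    (Function.iterate_succ_apply' _ _ _).symm.trans (iterate_shift_succ_val hσ hγ x m)
  simp only [Matrix.vecMul_eq_sum, map_sum, map_smulₛₗ, hrow]
  refine Fintype.sum_equiv (Equiv.addRight 1) _ _ fun m => ?_
  rw [Equiv.coe_addRight, shift_apply, add_sub_cancel_right, smul_smul, mul_comm]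
  rfl

theorem smul_det_layerMatrix [IsDomain R] (hσ : σ ^ n = 1) (hγ : σ • γ = γ) (h0 : γ ≠ 0)
    (x : Fin n → R) : σ • (layerMatrix σ γ x).det = (layerMatrix σ γ x).det := by
  let b := Pi.basisFun R (Fin n)
  have hshift : b.det (shift σ γ ∘ b) ≠ 0 := by
    intro h
    have hprod := prod_smul_det_eq_pow_card b (shift σ γ) (iterate_shift_eq_smul hσ hγ)
    simp [h, NeZero.ne n, eq_comm, h0] at hprod
  rw [← det_vecMulLinear]
  exact map_det_of_comp_semilinear b hshift (shift_vecMul_layerMatrix hσ hγ x)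

theorem det_layerMatrix_single_zero (hγ : σ • γ = γ) (a : R) :
    (layerMatrix σ γ (Pi.single (0 : Fin n) a)).det = ∏ m : Fin n, σ ^ m.val • a := by
  have hdiag : layerMatrix σ γ (Pi.single (0 : Fin n) a) =
      Matrix.diagonal fun m => σ ^ m.val • a := by
    ext m j
    rcases eq_or_ne m j with rfl | hmj
    · simp [layerMatrix_apply hγ]
    · simp [layerMatrix_apply hγ, hmj, sub_eq_zero, hmj.symm]
  rw [hdiag, Matrix.det_diagonal]

theorem layerMatrix_map {S : Type*} [CommRing S] [MulSemiringAction G S] {f : R →+* S}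
    (hf : ∀ (τ : G) (r : R), f (τ • r) = τ • f r) (hγ : σ • γ = γ) (x : Fin n → R) :
    (layerMatrix σ γ x).map f = layerMatrix σ (f γ) (f ∘ x) := by
  have hfγ : σ • f γ = f γ := by rw [← hf, hγ]
  ext m j
  simp [layerMatrix_apply, hγ, hfγ, apply_ite f, hf]

theorem det_mem_prod_of_mem {m : Type*} [Fintype m] [DecidableEq m] {J : m → Ideal R}
    {A : Matrix m m R} (hA : ∀ i j, A i j ∈ J i) : A.det ∈ ∏ i, J i := by
  rw [← A.det_transpose, Matrix.det_apply]
  exact Submodule.sum_mem _ fun τ _ =>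
    Submodule.smul_of_tower_mem _ _ (Ideal.prod_mem_prod fun i _ => hA i (τ i))

open scoped Pointwise in
theorem det_layerMatrix_mem_prod (hγ : σ • γ = γ) {J : Ideal R} {x : Fin n → R}
    (hx : ∀ l, x l ∈ J) : (layerMatrix σ γ x).det ∈ ∏ m : Fin n, σ ^ m.val • J := by
  refine det_mem_prod_of_mem fun m j => ?_
  rw [layerMatrix_apply hγ]
  exact Ideal.mul_mem_left _ _ (Ideal.smul_mem_pointwise_smul _ _ _ (hx _))

end CyclicAlgebra

section Galois

variable {K L : Type*} [Field K] [Field L] [Algebra K L] [FiniteDimensional K L] [IsGalois K L]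
  {σ : L ≃ₐ[K] L}

theorem pow_finrank_eq_one (σ : L ≃ₐ[K] L) : σ ^ Module.finrank K L = 1 := by
  rw [← IsGalois.card_aut_eq_finrank, pow_card_eq_one']

theorem algebraMap_norm_eq_prod_range (hσ : ∀ τ : L ≃ₐ[K] L, τ ∈ Subgroup.zpowers σ) (y : L) :
    algebraMap K L (Algebra.norm K y) =
      ∏ i ∈ Finset.range (Module.finrank K L), σ ^ i • y := by
  classical
  rw [Algebra.norm_eq_prod_automorphisms, ← IsCyclic.image_range_orderOf hσ,
    orderOf_eq_card_of_forall_mem_zpowers hσ, IsGalois.card_aut_eq_finrank, Finset.prod_image]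
  · rfl
  · rw [← IsGalois.card_aut_eq_finrank, ← orderOf_eq_card_of_forall_mem_zpowers hσ,
      Finset.coe_range]
    exact pow_injOn_Iio_orderOf

theorem exists_norm_eq_pow_finrank (hσ : ∀ τ : L ≃ₐ[K] L, τ ∈ Subgroup.zpowers σ) {γ : K}
    {V : Type*} [AddCommGroup V] [Module L V] [FiniteDimensional L V]
    (φ : V →ₛₗ[MulSemiringAction.toRingHom (L ≃ₐ[K] L) L σ] V)
    (hφ : ∀ v, φ^[Module.finrank K L] v = algebraMap K L γ • v) :
    ∃ y : L, Algebra.norm K y = γ ^ Module.finrank L V := by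
  let b := Module.finBasis L V
  refine ⟨b.det (φ ∘ b), (algebraMap K L).injective ?_⟩
  rw [algebraMap_norm_eq_prod_range hσ, prod_smul_det_eq_pow_card b φ hφ, Fintype.card_fin, map_pow]

theorem det_layerMatrix_ne_zero {n : ℕ} [NeZero n] (hn : Module.finrank K L = n)
    (hσ : ∀ τ : L ≃ₐ[K] L, τ ∈ Subgroup.zpowers σ) {γ : K}
    (hγ : ∀ j : ℕ, 0 < j → j < n → ∀ y : L, Algebra.norm K y ≠ γ ^ j)
    {x : Fin n → L} (hx : x ≠ 0) : (layerMatrix σ (algebraMap K L γ) x).det ≠ 0 := by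
  subst hn
  intro hdet
  have hσn : σ ^ Module.finrank K L = 1 := pow_finrank_eq_one σ
  have hσγ : σ • algebraMap K L γ = algebraMap K L γ := σ.commutes γ
  let A := layerMatrix σ (algebraMap K L γ) x
  let W := LinearMap.ker A.vecMulLinear
  have hW : ∀ v ∈ W, shift σ (algebraMap K L γ) v ∈ W := by
    intro v hv
    have h := shift_vecMul_layerMatrix hσn hσγ x v
    rw [show Matrix.vecMul v A = 0 from hv, map_zero] at h
    exact h.symm
  have hpos : 0 < Module.finrank L W := by
    rw [Module.finrank_pos_iff, Submodule.nontrivial_iff_ne_bot]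
    exact (LinearMap.bot_lt_ker_of_det_eq_zero ((det_vecMulLinear A).trans hdet)).ne'
  have hlt : Module.finrank L W < Module.finrank K L := by
    suffices W ≠ ⊤ by simpa using Submodule.finrank_lt this
    intro h
    have h0 : Pi.single 0 1 ∈ W := h ▸ Submodule.mem_top
    exact hx ((Matrix.single_one_vecMul 0 A).symm.trans h0)
  let φ := (shift σ (algebraMap K L γ)).restrict hW
  have hφ (w : W) : φ^[Module.finrank K L] w = algebraMap K L γ • w := by
    have hcoe : Function.Semiconj W.subtype φ (shift σ (algebraMap K L γ)) := fun _ => rfl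
    exact Subtype.ext ((hcoe.iterate_right _ w).trans (iterate_shift_eq_smul hσn hσγ w.1))
  obtain ⟨y, hy⟩ := exists_norm_eq_pow_finrank hσ φ hφ
  exact hγ _ hpos hlt y hy

end Galois

section ReducedNorm

open scoped Pointwise in
theorem absNorm_smul {G R : Type*} [Group G] [CommRing R] [IsDedekindDomain R]
    [Module.Free ℤ R] [MulSemiringAction G R] (g : G) (J : Ideal R) :
    Ideal.absNorm (g • J) = Ideal.absNorm J := by
  rw [Ideal.absNorm_apply, Ideal.absNorm_apply, Submodule.cardQuot_apply, Submodule.cardQuot_apply]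
  exact (Nat.card_congr
    (Ideal.quotientEquiv J _ (MulSemiringAction.toRingEquiv G R g) rfl).toEquiv).symm

variable {K L : Type*} [Field K] [NumberField K] [Field L] [NumberField L] [Algebra K L]
  [IsGalois K L] {n : ℕ} [NeZero n] {σ : L ≃ₐ[K] L} {γ : 𝓞 K}

theorem exists_algebraMap_eq_det_layerMatrix (hn : Module.finrank K L = n)
    (hσ : ∀ τ : L ≃ₐ[K] L, τ ∈ Subgroup.zpowers σ)
    (hγ : ∀ j : ℕ, 0 < j → j < n → ∀ y : L, Algebra.norm K y ≠ (γ : K) ^ j) (x : Fin n → 𝓞 L) :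
    ∃ d : 𝓞 K, algebraMap (𝓞 K) (𝓞 L) d =
      (layerMatrix σ (algebraMap (𝓞 K) (𝓞 L) γ) x).det := by
  set D := (layerMatrix σ (algebraMap (𝓞 K) (𝓞 L) γ) x).det
  have hσn : σ ^ n = 1 := hn ▸ pow_finrank_eq_one σ
  have hσD : σ • D = D := by
    rcases Nat.eq_or_lt_of_le (NeZero.one_le (n := n)) with h1 | h1
    · rw [← h1, pow_one] at hσn
      rw [hσn, one_smul]
    · refine smul_det_layerMatrix hσn (smul_algebraMap σ γ) (fun h0 => ?_) x
      rw [FaithfulSMul.algebraMap_eq_zero_iff] at h0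
      exact hγ 1 one_pos h1 0 (by simp [h0])
  refine Algebra.IsInvariant.isInvariant (G := L ≃ₐ[K] L) D fun τ => ?_
  exact Subgroup.zpowers_le.2 (show σ ∈ MulAction.stabilizer (L ≃ₐ[K] L) D from hσD) (hσ τ)

theorem absNorm_dvd_of_algebraMap_eq_det_layerMatrix (hn : Module.finrank K L = n)
    {J : Ideal (𝓞 L)} {x : Fin n → 𝓞 L} (hx : ∀ l, x l ∈ J) {d : 𝓞 K}
    (hd : algebraMap (𝓞 K) (𝓞 L) d = (layerMatrix σ (algebraMap (𝓞 K) (𝓞 L) γ) x).det) :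
    Ideal.absNorm J ∣ Ideal.absNorm (Ideal.span {d}) := by
  have hmem := det_layerMatrix_mem_prod (smul_algebraMap σ γ) hx
  rw [← hd, ← Ideal.span_singleton_le_iff_mem, ← Set.image_singleton, ← Ideal.map_span] at hmem
  have h := Ideal.absNorm_dvd_absNorm_of_le hmem
  have hfinrank : Module.finrank (𝓞 K) (𝓞 L) = n :=
    (IsFractionRing.finrank_eq (𝓞 K) K (𝓞 L) L).symm.trans hn
  simp only [Ideal.absNorm_algebraMap, map_prod, absNorm_smul, Finset.prod_const,
    Finset.card_univ, Fintype.card_fin, hfinrank] at h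
  exact (Nat.pow_dvd_pow_iff (NeZero.ne n)).1 h

end ReducedNorm

section ImaginaryQuadratic

open NumberField

variable {K : Type*} [Field K] [NumberField K]

theorem finrank_eq_two_of_cyclotomic
    (hK : IsCyclotomicExtension {4} ℚ K ∨ IsCyclotomicExtension {3} ℚ K) :
    Module.finrank ℚ K = 2 := by
  rcases hK with hK | hK
  · rw [IsCyclotomicExtension.finrank K (Polynomial.cyclotomic.irreducible_rat (n := 4) (by simp))]
    decide
  · rw [IsCyclotomicExtension.finrank K (Polynomial.cyclotomic.irreducible_rat (n := 3) (by simp))]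
    decide

theorem isTotallyComplex_of_cyclotomic
    (hK : IsCyclotomicExtension {4} ℚ K ∨ IsCyclotomicExtension {3} ℚ K) :
    IsTotallyComplex K := by
  rcases hK with hK | hK
  · exact IsCyclotomicExtension.Rat.isTotallyComplex K (n := 4) (by norm_num)
  · exact IsCyclotomicExtension.Rat.isTotallyComplex K (n := 3) (by norm_num)

theorem norm_eq_sq_norm_embedding [IsTotallyComplex K] (h2 : Module.finrank ℚ K = 2)
    (φ : K →+* ℂ) (a : K) : (Algebra.norm ℚ a : ℝ) = ‖φ a‖ ^ 2 := by
  classical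
  let φ' := ComplexEmbedding.conjugate φ
  have hne : φ.toRatAlgHom ≠ φ'.toRatAlgHom := fun h =>
    IsTotallyComplex.complexEmbedding_not_isReal φ
      (RingHom.ext fun x => (DFunLike.congr_fun h x).symm)
  have huniv : {φ.toRatAlgHom, φ'.toRatAlgHom} = (Finset.univ : Finset (K →ₐ[ℚ] ℂ)) :=
    Finset.eq_univ_of_card _ (by rw [Finset.card_pair hne, AlgHom.card, h2])
  have hprod : ((Algebra.norm ℚ a : ℚ) : ℂ) = φ a * starRingEnd ℂ (φ a) := by
    have h := Algebra.norm_eq_prod_embeddings ℚ ℂ a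
    rwa [← huniv, Finset.prod_pair hne] at h
  rw [Complex.mul_conj'] at hprod
  exact_mod_cast hprod

theorem abs_norm_eq_absNorm_span (x : 𝓞 K) :
    |Algebra.norm ℚ (x : K)| = (Ideal.absNorm (Ideal.span {x}) : ℚ) := by
  rw [Ideal.absNorm_span_singleton, ← Algebra.coe_norm_int, Nat.cast_natAbs, Int.cast_abs]

theorem norm_eq_absNorm_span_of_nonneg {x : 𝓞 K} (h : (0 : ℝ) ≤ Algebra.norm ℚ (x : K)) :
    (Algebra.norm ℚ (x : K) : ℝ) = Ideal.absNorm (Ideal.span {x}) := by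
  rw [← abs_of_nonneg h]
  exact_mod_cast congrArg ((↑) : ℚ → ℝ) (abs_norm_eq_absNorm_span x)

theorem sq_norm_embedding_eq_absNorm_span [IsTotallyComplex K] (h2 : Module.finrank ℚ K = 2)
    (φ : K →+* ℂ) (a : 𝓞 K) : ‖φ a‖ ^ 2 = (Ideal.absNorm (Ideal.span {a}) : ℝ) := by
  have h := norm_eq_sq_norm_embedding h2 φ (a : K)
  rw [← h, norm_eq_absNorm_span_of_nonneg (h ▸ sq_nonneg _)]

variable {L : Type*} [Field L] [NumberField L] [Algebra K L]

theorem norm_eq_sq_norm_embedding_norm [IsTotallyComplex K] (h2 : Module.finrank ℚ K = 2)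
    (ι : L →+* ℂ) (x : L) :
    (Algebra.norm ℚ x : ℝ) = ‖ι (algebraMap K L (Algebra.norm K x))‖ ^ 2 := by
  rw [← Algebra.norm_norm (S := K)]
  exact norm_eq_sq_norm_embedding h2 (ι.comp (algebraMap K L)) _

theorem norm_nonneg_of_isTotallyComplex [IsTotallyComplex K] (h2 : Module.finrank ℚ K = 2)
    (ι : L →+* ℂ) (x : L) : (0 : ℝ) ≤ Algebra.norm ℚ x :=
  norm_eq_sq_norm_embedding_norm h2 ι x ▸ sq_nonneg _

end ImaginaryQuadratic

section NormValues

variable {L : Type*} [Field L] [NumberField L]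

theorem isLeast_sInf_of_subset_range_natCast {s : Set ℝ} (hne : s.Nonempty)
    (hs : s ⊆ Set.range ((↑) : ℕ → ℝ)) : IsLeast s (sInf s) := by
  obtain ⟨t, rfl⟩ := Set.subset_range_iff_exists_image_eq.1 hs
  have ht : IsLeast t (sInf t) := isLeast_csInf hne.of_image
  have h := (Nat.mono_cast (α := ℝ)).map_isLeast ht
  rwa [h.csInf_eq]

theorem absNorm_lt_of_not_isPrincipal {R : Type*} [CommRing R] [IsDedekindDomain R]
    [Module.Free ℤ R] [Module.Finite ℤ R] {I : Ideal R} (hI : ¬ Submodule.IsPrincipal I) {x : R}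
    (hx : x ∈ I) (hx0 : x ≠ 0) : Ideal.absNorm I < Ideal.absNorm (Ideal.span {x}) := by
  obtain ⟨J, hJ⟩ := Ideal.dvd_span_singleton.2 hx
  have hne : Ideal.absNorm I * Ideal.absNorm J ≠ 0 := by
    rwa [← map_mul, ← hJ, Ne, Ideal.absNorm_eq_zero_iff, Ideal.span_singleton_eq_bot]
  have hJ1 : Ideal.absNorm J ≠ 1 := by
    rw [Ne, Ideal.absNorm_eq_one_iff]
    rintro rfl
    exact hI ⟨x, by rw [← Ideal.mul_top I, ← hJ]⟩
  rw [hJ, map_mul]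
  have hJ0 := right_ne_zero_of_mul hne
  exact lt_mul_of_one_lt_right (Nat.pos_of_ne_zero (left_ne_zero_of_mul hne)) (by omega)

theorem ne_bot_of_isCoprime_of_not_isPrincipal {R : Type*} [CommRing R] {I J : Ideal R}
    (hI : ¬ Submodule.IsPrincipal I) (h : IsCoprime I J) : J ≠ ⊥ := by
  rintro rfl
  rw [Ideal.isCoprime_iff_sup_eq, sup_bot_eq] at h
  exact hI (h ▸ inferInstance)

variable {I : Ideal (𝓞 L)}

theorem isLeast_normValues (hI : I ≠ ⊥) (hnorm : ∀ x : L, (0 : ℝ) ≤ Algebra.norm ℚ x) :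
    IsLeast (normValues I) (sInf (normValues I)) := by
  obtain ⟨a, haI, ha0⟩ := Submodule.exists_mem_ne_zero_of_ne_bot hI
  refine isLeast_sInf_of_subset_range_natCast ⟨_, a, haI, ha0, rfl⟩ ?_
  rintro _ ⟨x, -, -, rfl⟩
  exact ⟨_, (norm_eq_absNorm_span_of_nonneg (hnorm x)).symm⟩

theorem absNorm_pos (hI : I ≠ ⊥) : (0 : ℝ) < Ideal.absNorm I := by
  rwa [Nat.cast_pos, Nat.pos_iff_ne_zero, Ne, Ideal.absNorm_eq_zero_iff]

theorem gammaI_neg (hI : ¬ Submodule.IsPrincipal I)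
    (hnorm : ∀ x : L, (0 : ℝ) ≤ Algebra.norm ℚ x) : gammaI I < 0 := by
  have hI0 : I ≠ ⊥ := fun h => hI (h ▸ inferInstance)
  have hN := absNorm_pos hI0
  have hlt : (Ideal.absNorm I : ℝ) < sInf (normValues I) := by
    obtain ⟨x, hxI, hx0, hx⟩ := (isLeast_normValues hI0 hnorm).1
    rw [hx, norm_eq_absNorm_span_of_nonneg (hnorm x)]
    exact_mod_cast absNorm_lt_of_not_isPrincipal hI hxI hx0
  refine mul_neg_of_pos_of_neg (by norm_num) (Real.logb_neg (by norm_num) ?_ ?_)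
  · exact div_pos hN (hN.trans hlt)
  · exact (div_lt_one (hN.trans hlt)).2 hlt

end NormValues

section Codewords

variable {K L : Type*} [Field K] [Field L] [Algebra K L] {n : ℕ} (ι : L →+* ℂ) (σ : L ≃ₐ[K] L)
  (γ : 𝓞 K)

theorem codeword_add (x y : Fin n → 𝓞 L) :
    codeword ι σ γ (x + y) = codeword ι σ γ x + codeword ι σ γ y := by
  ext m j
  simp [codeword, mul_add]

theorem codeword_sub (x y : Fin n → 𝓞 L) :
    codeword ι σ γ (x - y) = codeword ι σ γ x - codeword ι σ γ y := by
  rw [eq_sub_iff_add_eq, ← codeword_add, sub_add_cancel]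

theorem det_mul_conjTranspose_eq_sq_norm {m : Type*} [Fintype m] [DecidableEq m]
    (A : Matrix m m ℂ) : (A * A.conjTranspose).det = ((‖A.det‖ ^ 2 : ℝ) : ℂ) := by
  rw [Matrix.det_mul, Matrix.det_conjTranspose, RCLike.star_def, Complex.mul_conj',
    Complex.ofReal_pow]

open scoped Pointwise in
theorem detValues_vadd (X : Matrix (Fin n) (Fin n) ℂ) (C : Set (Matrix (Fin n) (Fin n) ℂ)) :
    detValues (X +ᵥ C) = detValues C := by
  ext d
  simp [detValues, Set.mem_vadd_set]

variable [NeZero n]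

theorem codeword_eq_map (x : Fin n → 𝓞 L) :
    codeword ι σ γ x =
      (layerMatrix σ (algebraMap (𝓞 K) (𝓞 L) γ) x).map (ι.comp (algebraMap (𝓞 L) L)) := by
  have hγ : σ • algebraMap (𝓞 K) (𝓞 L) γ = algebraMap (𝓞 K) (𝓞 L) γ :=
    NumberField.RingOfIntegers.ext (σ.commutes γ)
  ext m j
  rw [Matrix.map_apply, layerMatrix_apply hγ, RingHom.comp_apply, map_mul,
    apply_ite (algebraMap (𝓞 L) L), map_one]
  rfl

theorem det_codeword (x : Fin n → 𝓞 L) :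
    (codeword ι σ γ x).det =
      ι (algebraMap (𝓞 L) L (layerMatrix σ (algebraMap (𝓞 K) (𝓞 L) γ) x).det) := by
  rw [codeword_eq_map, ← RingHom.mapMatrix_apply, ← RingHom.map_det, RingHom.comp_apply]

theorem codeword_injective :
    Function.Injective (codeword ι σ γ : (Fin n → 𝓞 L) → Matrix (Fin n) (Fin n) ℂ) := by
  intro x y h
  ext j
  have h0 : ι (x j) = ι (y j) := by simpa [codeword] using congrFun (congrFun h 0) j
  exact ι.injective h0

theorem detValues_idealCode (J : Ideal (𝓞 L)) :
    detValues (idealCode n ι σ γ J) =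
      (fun x => ‖(codeword ι σ γ x).det‖ ^ 2) '' {x : Fin n → 𝓞 L | (∀ l, x l ∈ J) ∧ x ≠ 0} := by
  have hcast (d : ℝ) (x y : Fin n → 𝓞 L) :
      (d : ℂ) = ((codeword ι σ γ x - codeword ι σ γ y) *
        (codeword ι σ γ x - codeword ι σ γ y).conjTranspose).det ↔
      ‖(codeword ι σ γ (x - y)).det‖ ^ 2 = d := by
    rw [← codeword_sub, det_mul_conjTranspose_eq_sq_norm, Complex.ofReal_inj, eq_comm]
  ext d
  constructor
  · rintro ⟨_, ⟨x, hx, rfl⟩, _, ⟨y, hy, rfl⟩, hne, hd⟩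
    have hxy : x - y ≠ 0 := sub_ne_zero.2 fun h => hne (h ▸ rfl)
    exact ⟨x - y, ⟨fun l => sub_mem (hx l) (hy l), hxy⟩, (hcast d x y).1 hd⟩
  · rintro ⟨x, ⟨hx, hx0⟩, hd⟩
    refine ⟨_, ⟨x, hx, rfl⟩, _, ⟨0, fun _ => J.zero_mem, rfl⟩, (codeword_injective ι σ γ).ne hx0,
      ?_⟩
    rw [hcast, sub_zero, ← hd]

end Codewords

section MinimumDeterminant

open NumberField

variable {K L : Type*} [Field K] [NumberField K] [Field L] [NumberField L] [Algebra K L]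
  [IsGalois K L] {n : ℕ} [NeZero n] {σ : L ≃ₐ[K] L} {γ : 𝓞 K} (ι : L →+* ℂ) {J : Ideal (𝓞 L)}

theorem det_codeword_ne_zero (hn : Module.finrank K L = n)
    (hσ : ∀ τ : L ≃ₐ[K] L, τ ∈ Subgroup.zpowers σ)
    (hγ : ∀ j : ℕ, 0 < j → j < n → ∀ y : L, Algebra.norm K y ≠ (γ : K) ^ j)
    {x : Fin n → 𝓞 L} (hx : x ≠ 0) : (codeword ι σ γ x).det ≠ 0 := by
  have : FiniteDimensional K L := Module.Finite.of_restrictScalars_finite ℚ K L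
  have hinj : Function.Injective (algebraMap (𝓞 L) L) := RingOfIntegers.coe_injective
  have hx' : algebraMap (𝓞 L) L ∘ x ≠ 0 := fun h =>
    hx (funext fun l => hinj ((congrFun h l).trans (map_zero _).symm))
  rw [det_codeword, Ne, map_eq_zero, RingHom.map_det, RingHom.mapMatrix_apply,
    layerMatrix_map (fun _ _ => rfl) (smul_algebraMap σ γ)]
  exact det_layerMatrix_ne_zero hn hσ hγ hx'

variable [IsTotallyComplex K]

theorem sq_norm_det_codeword_single (h2 : Module.finrank ℚ K = 2) (hn : Module.finrank K L = n)
    (hσ : ∀ τ : L ≃ₐ[K] L, τ ∈ Subgroup.zpowers σ) (a : 𝓞 L) :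
    ‖(codeword ι σ γ (Pi.single (0 : Fin n) a)).det‖ ^ 2 = Algebra.norm ℚ (a : L) := by
  have : FiniteDimensional K L := Module.Finite.of_restrictScalars_finite ℚ K L
  rw [norm_eq_sq_norm_embedding_norm h2 ι, algebraMap_norm_eq_prod_range hσ, hn, det_codeword,
    det_layerMatrix_single_zero (smul_algebraMap σ γ), map_prod,
    Fin.prod_univ_eq_prod_range fun i => algebraMap (𝓞 L) L (σ ^ i • a)]
  rfl

theorem exists_absNorm_mul_eq_sq_norm_det_codeword (h2 : Module.finrank ℚ K = 2)
    (hn : Module.finrank K L = n) (hσ : ∀ τ : L ≃ₐ[K] L, τ ∈ Subgroup.zpowers σ)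
    (hγ : ∀ j : ℕ, 0 < j → j < n → ∀ y : L, Algebra.norm K y ≠ (γ : K) ^ j)
    {x : Fin n → 𝓞 L} (hx : ∀ l, x l ∈ J) :
    ∃ m : ℕ, ((Ideal.absNorm J * m : ℕ) : ℝ) = ‖(codeword ι σ γ x).det‖ ^ 2 := by
  obtain ⟨d, hd⟩ := exists_algebraMap_eq_det_layerMatrix hn hσ hγ x
  obtain ⟨m, hm⟩ := absNorm_dvd_of_algebraMap_eq_det_layerMatrix hn hx hd
  refine ⟨m, ?_⟩
  rw [← hm, det_codeword, ← hd]
  exact (sq_norm_embedding_eq_absNorm_span h2 (ι.comp (algebraMap K L)) d).symm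

theorem isLeast_minDet_idealCode (h2 : Module.finrank ℚ K = 2) (hn : Module.finrank K L = n)
    (hσ : ∀ τ : L ≃ₐ[K] L, τ ∈ Subgroup.zpowers σ)
    (hγ : ∀ j : ℕ, 0 < j → j < n → ∀ y : L, Algebra.norm K y ≠ (γ : K) ^ j) (hJ : J ≠ ⊥) :
    IsLeast (detValues (idealCode n ι σ γ J)) (minDet (idealCode n ι σ γ J)) := by
  obtain ⟨a, haJ, ha0⟩ := Submodule.exists_mem_ne_zero_of_ne_bot hJ
  refine isLeast_sInf_of_subset_range_natCast ?_ ?_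
  · rw [detValues_idealCode]
    exact Set.Nonempty.image _ ⟨fun _ => a, fun _ => haJ, fun h => ha0 (congrFun h 0)⟩
  · rw [detValues_idealCode]
    rintro _ ⟨x, ⟨hx, -⟩, rfl⟩
    obtain ⟨m, hm⟩ := exists_absNorm_mul_eq_sq_norm_det_codeword ι h2 hn hσ hγ hx
    exact ⟨_, hm⟩

theorem absNorm_le_minDet_idealCode (h2 : Module.finrank ℚ K = 2) (hn : Module.finrank K L = n)
    (hσ : ∀ τ : L ≃ₐ[K] L, τ ∈ Subgroup.zpowers σ)
    (hγ : ∀ j : ℕ, 0 < j → j < n → ∀ y : L, Algebra.norm K y ≠ (γ : K) ^ j) (hJ : J ≠ ⊥) :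
    Ideal.absNorm J ≤ minDet (idealCode n ι σ γ J) := by
  have hleast := (isLeast_minDet_idealCode ι h2 hn hσ hγ hJ).1
  rw [detValues_idealCode] at hleast
  obtain ⟨x, ⟨hx, hx0⟩, hdet⟩ := hleast
  obtain ⟨m, hm⟩ := exists_absNorm_mul_eq_sq_norm_det_codeword ι h2 hn hσ hγ hx
  have hpos : 0 < ‖(codeword ι σ γ x).det‖ ^ 2 := by
    have := det_codeword_ne_zero ι hn hσ hγ hx0
    positivity
  rw [← hm, Nat.cast_pos] at hpos
  rw [← hdet]
  dsimp only
  rw [← hm, Nat.cast_le]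
  exact Nat.le_mul_of_pos_right _ (Nat.pos_of_mul_pos_left hpos)

theorem normValues_subset_detValues_idealCode (h2 : Module.finrank ℚ K = 2)
    (hn : Module.finrank K L = n) (hσ : ∀ τ : L ≃ₐ[K] L, τ ∈ Subgroup.zpowers σ) :
    normValues J ⊆ detValues (idealCode n ι σ γ J) := by
  rw [detValues_idealCode]
  rintro _ ⟨a, haJ, ha0, rfl⟩
  refine ⟨Pi.single 0 a, ⟨fun l => ?_, by simpa using ha0⟩,
    sq_norm_det_codeword_single ι h2 hn hσ a⟩
  rcases eq_or_ne l 0 with rfl | hl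
  · simpa using haJ
  · simp [hl]

end MinimumDeterminant

section Encoding

variable {L : Type*} [Field L] {n κ : ℕ} {I : Ideal (𝓞 L)} {q : Fin κ → Ideal (𝓞 L)}
  {hq : Pairwise fun i j => IsCoprime (q i) (q j)} {hI : ∀ k, IsCoprime I (q k)}
  {leader : I ⧸ shaping I q → I}

theorem mem_mul_prod_iff {R ι : Type*} [CommRing R] {I : Ideal R} {q : ι → Ideal R}
    (hq : Pairwise fun i j => IsCoprime (q i) (q j)) (hI : ∀ k, IsCoprime I (q k)) (S : Finset ι)
    {a : R} : a ∈ I * ∏ s ∈ S, q s ↔ a ∈ I ∧ ∀ s ∈ S, a ∈ q s := by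
  rw [Ideal.mul_eq_inf_of_isCoprime (IsCoprime.prod_right fun k _ => hI k),
    Ideal.prod_eq_iInf_of_pairwise_isCoprime fun i _ j _ h => hq h]
  simp

theorem residues_leader (hleader : ∀ c, (shaping I q).mkQ (leader c) = c)
    (c : I ⧸ shaping I q) : residues I q (leader c) = layerEquiv I q hq hI c := by
  conv_rhs => rw [← hleader c]
  rfl

theorem mk_layers (hleader : ∀ c, (shaping I q).mkQ (leader c) = c)
    (w : (k : Fin κ) → Fin n → 𝓞 L ⧸ q k) (k : Fin κ) (l : Fin n) :
    Ideal.Quotient.mk (q k) (layers I q hq hI leader w l) = w k l := by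
  have h := residues_leader (hq := hq) (hI := hI) hleader
    ((layerEquiv I q hq hI).symm fun k => w k l)
  rw [LinearEquiv.apply_symm_apply] at h
  exact congrFun h k

theorem layers_mem (w : (k : Fin κ) → Fin n → 𝓞 L ⧸ q k) (l : Fin n) :
    layers I q hq hI leader w l ∈ I := Subtype.property _

theorem layers_add_sub_layers_mem (hleader : ∀ c, (shaping I q).mkQ (leader c) = c)
    {S : Finset (Fin κ)} {v w : (k : Fin κ) → Fin n → 𝓞 L ⧸ q k} (hw : ∀ s ∈ S, w s = v s)
    {y : Fin n → 𝓞 L} (hy : ∀ l, y l ∈ I * ∏ k, q k) (l : Fin n) :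
    layers I q hq hI leader w l + y l - layers I q hq hI leader v l ∈ I * ∏ s ∈ S, q s := by
  simp only [mem_mul_prod_iff hq hI] at hy ⊢
  refine ⟨sub_mem (add_mem (layers_mem w l) (hy l).1) (layers_mem v l), fun s hs => ?_⟩
  rw [← Ideal.Quotient.eq, map_add,
    Ideal.Quotient.eq_zero_iff_mem.2 ((hy l).2 s (Finset.mem_univ s)), mk_layers hleader,
    mk_layers hleader, hw s hs, add_zero]

variable {K : Type*} [Field K] [Algebra K L] {ι : L →+* ℂ} {σ : L ≃ₐ[K] L} {γ : 𝓞 K}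

theorem codebook_eq_subcode_empty (v : (k : Fin κ) → Fin n → 𝓞 L ⧸ q k) :
    codebook n ι σ γ I q hq hI leader = subcode ι σ γ I q hq hI leader ∅ v := by
  simp [codebook, subcode]

open scoped Pointwise in
theorem periodic_subcode (hleader : ∀ c, (shaping I q).mkQ (leader c) = c) (S : Finset (Fin κ))
    (v : (k : Fin κ) → Fin n → 𝓞 L ⧸ q k) :
    periodic ι σ γ I q (subcode ι σ γ I q hq hI leader S v) =
      codeword ι σ γ (layers I q hq hI leader v) +ᵥ
        idealCode n ι σ γ (I * ∏ s ∈ S, q s) := by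
  ext Z
  rw [Set.mem_vadd_set]
  constructor
  · rintro ⟨_, ⟨w, hw, rfl⟩, _, ⟨y, hy, rfl⟩, rfl⟩
    refine ⟨_, ⟨layers I q hq hI leader w + y - layers I q hq hI leader v,
      layers_add_sub_layers_mem hleader hw hy, rfl⟩, ?_⟩
    rw [vadd_eq_add, ← codeword_add, ← codeword_add, add_sub_cancel]
  · rintro ⟨_, ⟨x, hx, rfl⟩, rfl⟩
    let u := layers I q hq hI leader v + x
    let w (k : Fin κ) (l : Fin n) : 𝓞 L ⧸ q k := Ideal.Quotient.mk (q k) (u l)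
    simp only [mem_mul_prod_iff hq hI] at hx
    have hw : ∀ s ∈ S, w s = v s := fun s hs => funext fun l => by
      rw [← mk_layers (hq := hq) (hI := hI) hleader v s l]
      exact Ideal.Quotient.eq.2 (by simpa [u] using (hx l).2 s hs)
    refine ⟨_, ⟨w, hw, rfl⟩, _, ⟨u - layers I q hq hI leader w, fun l => ?_, rfl⟩, ?_⟩
    · rw [mem_mul_prod_iff hq hI]
      refine ⟨sub_mem (add_mem (layers_mem v l) (hx l).1) (layers_mem w l), fun k _ => ?_⟩
      rw [Pi.sub_apply, ← Ideal.Quotient.eq, mk_layers hleader]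
    · rw [vadd_eq_add, ← codeword_add, ← codeword_add, add_sub_cancel]

theorem detValues_periodic_subcode (hleader : ∀ c, (shaping I q).mkQ (leader c) = c)
    (S : Finset (Fin κ)) (v : (k : Fin κ) → Fin n → 𝓞 L ⧸ q k) :
    detValues (periodic ι σ γ I q (subcode ι σ γ I q hq hI leader S v)) =
      detValues (idealCode n ι σ γ (I * ∏ s ∈ S, q s)) := by
  rw [periodic_subcode hleader, detValues_vadd]

theorem detValues_periodic_codebook (hleader : ∀ c, (shaping I q).mkQ (leader c) = c) :
    detValues (periodic ι σ γ I q (codebook n ι σ γ I q hq hI leader)) =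
      detValues (idealCode n ι σ γ I) := by
  rw [codebook_eq_subcode_empty 0, detValues_periodic_subcode hleader, Finset.prod_empty, mul_one]

end Encoding

section Gain

theorem gain_congr {n : ℕ} {C C' D D' : Set (Matrix (Fin n) (Fin n) ℂ)}
    (hC : detValues C = detValues C') (hD : detValues D = detValues D') (R : ℝ) :
    gain C D R = gain C' D' R := by
  rw [gain, gain, minDet, minDet, minDet, minDet, hC, hD]

theorem le_logb_ten_div {N M δ δ' Q : ℝ} (hN : 0 < N) (hNM : N ≤ M) (hδ : 0 < δ) (hδM : δ ≤ M)
    (hQ : 2 ≤ Q) (hδ' : N * Q ≤ δ') :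
    20 * Real.logb 10 2 + 20 * Real.logb 10 (N / M) ≤
      10 * Real.logb 10 (δ' / δ) / (Real.logb 2 Q / 2) := by
  have hM : 0 < M := hN.trans_le hNM
  have hQ0 : 0 < Q := by linarith
  have hlogQ : 1 ≤ Real.logb 2 Q := by
    rw [Real.le_logb_iff_rpow_le (by norm_num) hQ0]
    simpa using hQ
  have hneg : Real.logb 10 (N / M) ≤ 0 :=
    Real.logb_nonpos (by norm_num) (by positivity) ((div_le_one hM).2 hNM)
  have hchange : Real.logb 10 2 * Real.logb 2 Q = Real.logb 10 Q :=
    Real.mul_logb (by norm_num) (by norm_num) (by norm_num)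
  have hratio : Q * (N / M) ≤ δ' / δ := by
    rw [mul_div_assoc', div_le_div_iff₀ hM hδ]
    nlinarith [mul_pos hN hQ0]
  have hlog : Real.logb 10 Q + Real.logb 10 (N / M) ≤ Real.logb 10 (δ' / δ) := by
    rw [← Real.logb_mul hQ0.ne' (by positivity)]
    exact Real.logb_le_logb_of_le (by norm_num) (by positivity) hratio
  -- `log (N / M) ≤ 0` is multiplied by `log₂ Q / 2 ≥ 1 / 2`, which only lowers it.
  rw [le_div_iff₀ (by linarith)]
  nlinarith [mul_nonneg (sub_nonneg.2 hlogQ) (neg_nonneg.2 hneg)]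

theorem six_le_logb_ten_two : (6 : ℝ) ≤ 20 * Real.logb 10 2 := by
  have h : Real.logb 10 ((10 : ℝ) ^ 6) ≤ Real.logb 10 ((2 : ℝ) ^ 20) :=
    Real.logb_le_logb_of_le (by norm_num) (by norm_num) (by norm_num)
  rw [Real.logb_pow, Real.logb_pow, Real.logb_self_eq_one (by norm_num)] at h
  norm_num at h
  exact h

variable {L : Type*} [Field L] [NumberField L] {n κ : ℕ}

theorem messageRate_eq (hn : n ≠ 0) (J : Ideal (𝓞 L)) :
    messageRate n J = Real.logb 2 (Ideal.absNorm J) / (2 * n) := by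
  have h : Nat.card (Fin n → 𝓞 L ⧸ J) = Ideal.absNorm J ^ n := by
    rw [Nat.card_fun, Nat.card_fin, Ideal.absNorm_apply, Submodule.cardQuot_apply]
  rw [messageRate, h, Nat.cast_pow, Real.logb_pow]
  field_simp

theorem sideInfoRate_eq (hn : n ≠ 0) {q : Fin κ → Ideal (𝓞 L)} (hq : ∀ k, q k ≠ ⊥)
    (S : Finset (Fin κ)) :
    sideInfoRate n q S = Real.logb 2 (Ideal.absNorm (∏ s ∈ S, q s)) / (2 * n) := by
  rw [sideInfoRate, Finset.sum_congr rfl fun s _ => messageRate_eq hn (q s), ← Finset.sum_div,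
    map_prod, Nat.cast_prod, Real.logb_prod _ _ fun s _ => (absNorm_pos (hq s)).ne']

theorem two_le_absNorm_of_sideInfoRate_pos (hn : n ≠ 0) {q : Fin κ → Ideal (𝓞 L)}
    (hq : ∀ k, q k ≠ ⊥) {S : Finset (Fin κ)} (hR : 0 < sideInfoRate n q S) :
    2 ≤ Ideal.absNorm (∏ s ∈ S, q s) := by
  rw [sideInfoRate_eq hn hq] at hR
  by_contra! h
  interval_cases Ideal.absNorm (∏ s ∈ S, q s) <;> simp at hR

variable {K : Type*} [Field K] [NumberField K] [Algebra K L] [IsGalois K L] [NeZero n]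
  {σ : L ≃ₐ[K] L} {γ : 𝓞 K} (ι : L →+* ℂ) [NumberField.IsTotallyComplex K]

theorem le_gain_idealCode (h2 : Module.finrank ℚ K = 2) (hn : Module.finrank K L = n)
    (hσ : ∀ τ : L ≃ₐ[K] L, τ ∈ Subgroup.zpowers σ)
    (hγ : ∀ j : ℕ, 0 < j → j < n → ∀ y : L, Algebra.norm K y ≠ (γ : K) ^ j)
    {I : Ideal (𝓞 L)} (hI : I ≠ ⊥) {q : Fin κ → Ideal (𝓞 L)} (hq : ∀ k, q k ≠ ⊥)
    {S : Finset (Fin κ)} (hR : 0 < sideInfoRate n q S) :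
    20 * Real.logb 10 2 + gammaI I ≤
      gain (idealCode n ι σ γ I) (idealCode n ι σ γ (I * ∏ s ∈ S, q s))
        (sideInfoRate n q S) := by
  have hIle := absNorm_le_minDet_idealCode ι h2 hn hσ hγ hI
  have hIq : I * ∏ s ∈ S, q s ≠ ⊥ := mul_ne_zero hI (Finset.prod_ne_zero_iff.2 fun k _ => hq k)
  have hIqle := absNorm_le_minDet_idealCode ι h2 hn hσ hγ hIq
  have hsub := normValues_subset_detValues_idealCode (γ := γ) ι h2 hn hσ (J := I)
  have hnorm := isLeast_normValues hI (norm_nonneg_of_isTotallyComplex h2 ι)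
  have hmin : minDet (idealCode n ι σ γ I) ≤ sInf (normValues I) :=
    (isLeast_minDet_idealCode ι h2 hn hσ hγ hI).2 (hsub hnorm.1)
  have hrate : n * sideInfoRate n q S = Real.logb 2 (Ideal.absNorm (∏ s ∈ S, q s)) / 2 := by
    rw [sideInfoRate_eq (NeZero.ne n) hq]
    have := NeZero.ne n
    field_simp
  rw [map_mul, Nat.cast_mul] at hIqle
  rw [gammaI, gain, hrate]
  exact le_logb_ten_div (absNorm_pos hI) (hIle.trans hmin) ((absNorm_pos hI).trans_le hIle) hmin
    (by exact_mod_cast two_le_absNorm_of_sideInfoRate_pos (NeZero.ne n) hq hR) hIqle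

end Gain

end LSTIC

open LSTIC in
theorem theorem2_general
    {K L : Type*} [Field K] [NumberField K] [Field L] [NumberField L] [Algebra K L]
    [NumberField.IsTotallyComplex K] (h2 : Module.finrank ℚ K = 2)
    [IsGalois K L] (n : ℕ) (hn : Module.finrank K L = n)
    (σ : L ≃ₐ[K] L) (hσ : ∀ τ : L ≃ₐ[K] L, τ ∈ Subgroup.zpowers σ)
    (γ : 𝓞 K) (hγ : ∀ j : ℕ, 0 < j → j < n → ∀ y : L, Algebra.norm K y ≠ (γ : K) ^ j)
    (ι : L →+* ℂ)
    (I : Ideal (𝓞 L)) (hI : ¬ Submodule.IsPrincipal I)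
    (κ : ℕ) (q : Fin κ → Ideal (𝓞 L))
    (hq : Pairwise fun i j => IsCoprime (q i) (q j))
    (hIq : ∀ k, IsCoprime I (q k))
    (leader : I ⧸ shaping I q → I)
    (hleader : ∀ c, (shaping I q).mkQ (leader c) = c) :
    IsLeast (normValues I) (sInf (normValues I)) ∧
    gammaI I < 0 ∧
    (IsLeast
        (detValues (periodic ι σ γ I q (codebook n ι σ γ I q hq hIq leader)))
        (minDet (periodic ι σ γ I q (codebook n ι σ γ I q hq hIq leader))) ∧
      0 < minDet (periodic ι σ γ I q (codebook n ι σ γ I q hq hIq leader))) ∧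
    ∀ (S : Finset (Fin κ)) (v : (k : Fin κ) → Fin n → 𝓞 L ⧸ q k),
      IsLeast
        (detValues (periodic ι σ γ I q (subcode ι σ γ I q hq hIq leader S v)))
        (minDet (periodic ι σ γ I q (subcode ι σ γ I q hq hIq leader S v))) ∧
      (0 < sideInfoRate n q S →
        6 + gammaI I ≤
            gain
              (periodic ι σ γ I q (codebook n ι σ γ I q hq hIq leader))
              (periodic ι σ γ I q (subcode ι σ γ I q hq hIq leader S v))
              (sideInfoRate n q S) ∧
        20 * Real.logb 10 2 + gammaI I ≤
            gain
              (periodic ι σ γ I q (codebook n ι σ γ I q hq hIq leader))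
              (periodic ι σ γ I q (subcode ι σ γ I q hq hIq leader S v))
              (sideInfoRate n q S)) := by
  have : FiniteDimensional K L := Module.Finite.of_restrictScalars_finite ℚ K L
  have : NeZero n := ⟨hn ▸ Module.finrank_pos.ne'⟩
  have hI0 : I ≠ ⊥ := fun h => hI (h ▸ inferInstance)
  have hq0 (k : Fin κ) : q k ≠ ⊥ := ne_bot_of_isCoprime_of_not_isPrincipal hI (hIq k)
  have hnorm := norm_nonneg_of_isTotallyComplex h2 ι
  have hcode := detValues_periodic_codebook (n := n) (ι := ι) (σ := σ) (γ := γ) (hq := hq)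
    (hI := hIq) hleader
  have hIS (S : Finset (Fin κ)) : I * ∏ s ∈ S, q s ≠ ⊥ :=
    mul_ne_zero hI0 (Finset.prod_ne_zero_iff.2 fun k _ => hq0 k)
  refine ⟨isLeast_normValues hI0 hnorm, gammaI_neg hI hnorm, ?_, fun S v => ?_⟩
  · rw [minDet, hcode]
    exact ⟨isLeast_minDet_idealCode ι h2 hn hσ hγ hI0,
      (absNorm_pos hI0).trans_le (absNorm_le_minDet_idealCode ι h2 hn hσ hγ hI0)⟩
  · have hsub := detValues_periodic_subcode (ι := ι) (σ := σ) (γ := γ) (hq := hq) (hI := hIq)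
      hleader S v
    rw [minDet, gain_congr hcode hsub, hsub]
    refine ⟨isLeast_minDet_idealCode ι h2 hn hσ hγ (hIS S), fun hR => ?_⟩
    have hgain := le_gain_idealCode ι h2 hn hσ hγ hI0 hq0 hR
    exact ⟨(add_le_add_left six_le_logb_ten_two _).trans hgain, hgain⟩

theorem theorem2
    {K L : Type*} [Field K] [NumberField K] [Field L] [NumberField L] [Algebra K L]
    -- the base field is `ℚ(i)` or `ℚ(ω)`
    (hK : IsCyclotomicExtension {4} ℚ K ∨ IsCyclotomicExtension {3} ℚ K)
    -- `L/K` is cyclic of degree `n`, with Galois group generated by `σ`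
    [IsGalois K L] (n : ℕ) (hn : Module.finrank K L = n)
    (σ : L ≃ₐ[K] L) (hσ : ∀ τ : L ≃ₐ[K] L, τ ∈ Subgroup.zpowers σ)
    -- none of `γ, …, γ ^ (n - 1)` is a norm from `L`
    (γ : 𝓞 K) (hγ : ∀ j : ℕ, 0 < j → j < n → ∀ y : L, Algebra.norm K y ≠ (γ : K) ^ j)
    -- entries of codewords are read in `ℂ`
    (ι : L →+* ℂ)
    (I : Ideal (𝓞 L)) (hI : ¬ Submodule.IsPrincipal I)
    (κ : ℕ) (q : Fin κ → Ideal (𝓞 L))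
    (hq : Pairwise fun i j => IsCoprime (q i) (q j))
    (hIq : ∀ k, IsCoprime I (q k))
    -- a complete set of coset leaders of `I/I𝔮`
    (leader : I ⧸ LSTIC.shaping I q → I)
    (hleader : ∀ c, (LSTIC.shaping I q).mkQ (leader c) = c) :
    -- the minimum in `γ_I` exists, and `γ_I` is negative
    IsLeast (LSTIC.normValues I) (sInf (LSTIC.normValues I)) ∧
    LSTIC.gammaI I < 0 ∧
    -- the minimum determinant of the code exists and is positive
    (IsLeast
        (LSTIC.detValues (LSTIC.periodic ι σ γ I q (LSTIC.codebook n ι σ γ I q hq hIq leader)))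
        (LSTIC.minDet (LSTIC.periodic ι σ γ I q (LSTIC.codebook n ι σ γ I q hq hIq leader))) ∧
      0 < LSTIC.minDet (LSTIC.periodic ι σ γ I q (LSTIC.codebook n ι σ γ I q hq hIq leader))) ∧
    ∀ (S : Finset (Fin κ)) (v : (k : Fin κ) → Fin n → 𝓞 L ⧸ q k),
      -- so does that of the subcode for the side information `v_s`, `s ∈ S`
      IsLeast
        (LSTIC.detValues (LSTIC.periodic ι σ γ I q (LSTIC.subcode ι σ γ I q hq hIq leader S v)))
        (LSTIC.minDet (LSTIC.periodic ι σ γ I q (LSTIC.subcode ι σ γ I q hq hIq leader S v))) ∧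
      -- the gain is defined when the side information has positive rate
      (0 < LSTIC.sideInfoRate n q S →
        6 + LSTIC.gammaI I ≤
            LSTIC.gain
              (LSTIC.periodic ι σ γ I q (LSTIC.codebook n ι σ γ I q hq hIq leader))
              (LSTIC.periodic ι σ γ I q (LSTIC.subcode ι σ γ I q hq hIq leader S v))
              (LSTIC.sideInfoRate n q S) ∧
        20 * Real.logb 10 2 + LSTIC.gammaI I ≤
            LSTIC.gain
              (LSTIC.periodic ι σ γ I q (LSTIC.codebook n ι σ γ I q hq hIq leader))
              (LSTIC.periodic ι σ γ I q (LSTIC.subcode ι σ γ I q hq hIq leader S v))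
              (LSTIC.sideInfoRate n q S)) :=
  have := LSTIC.isTotallyComplex_of_cyclotomic hK
  theorem2_general (LSTIC.finrank_eq_two_of_cyclotomic hK) n hn σ hσ γ hγ ι I hI κ q hq hIq
    leader hleader
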